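/- Let $\mathfrak{s}$ be a finite-dimensional real solvable Lie algebra that is not unimodular, i.e. $\operatorname{trace}(\operatorname{ad}(X))\neq 0$ for some $X\in\mathfrak{s}$. Then for every inner product $Q$ on $\mathfrak{s}$, the Ricci operator of the metric Lie algebra $(\mathfrak{s},Q)$ has at least two negative eigenvalues, counted with multiplicity. Here the Ricci operator $\operatorname{Ric}\colon\mathfrak{s}\to\mathfrak{s}$ of $(\mathfrak{s},Q)$ is that of the left-invariant Riemannian metric determined by $Q$ on a Lie group with Lie algebra $\mathfrak{s}$: it is given by $Q(\operatorname{Ric}X,Y)=\operatorname{trace}\bigl(Z\mapsto R(Z,X)Y\bigr)$, where $R(Z,X)=\nabla_Z\nabla_X-\nabla_X\nabla_Z-\nabla_{[Z,X]}$ and $2Q(\nabla_XY,Z)=Q([X,Y],Z)-Q([Y,Z],X)+Q([Z,X],Y)$ for all $X,Y,Z\in\mathfrak{s}$. -/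

import Mathlib

noncomputable section

namespace MetricLie

variable {s : Type*} [LieRing s] [LieAlgebra ℝ s]

/-- A Lie algebra is unimodular if all its operators `ad X` are trace-free. -/
def IsUnimodular (s : Type*) [LieRing s] [LieAlgebra ℝ s] : Prop :=
  ∀ X : s, LinearMap.trace ℝ s (LieAlgebra.ad ℝ s X) = 0

/-- An inner product on a real Lie algebra: a symmetric positive definite bilinear form
(no compatibility with the bracket is required). -/
structure IsInnerProduct (Q : LinearMap.BilinForm ℝ s) : Prop where
  symm : ∀ X Y : s, Q X Y = Q Y X
  pos : ∀ X : s, X ≠ 0 → 0 < Q X X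

theorem IsInnerProduct.nondegenerate {Q : LinearMap.BilinForm ℝ s} (hQ : IsInnerProduct Q) :
    Q.Nondegenerate := by
  constructor
  · intro X h
    by_contra hX
    exact (hQ.pos X hX).ne' (h X)
  · intro X h
    by_contra hX
    exact (hQ.pos X hX).ne' (h X)

variable [FiniteDimensional ℝ s]

/-- The vector that represents a linear functional with respect to the inner product `Q`. -/
def represent (Q : LinearMap.BilinForm ℝ s) (hQ : IsInnerProduct Q) : Module.Dual ℝ s →ₗ[ℝ] s :=
  (Q.toDual hQ.nondegenerate).symm.toLinearMap

theorem represent_spec (Q : LinearMap.BilinForm ℝ s) (hQ : IsInnerProduct Q)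
    (φ : Module.Dual ℝ s) (Z : s) : Q (represent Q hQ φ) Z = φ Z :=
  LinearMap.BilinForm.apply_toDual_symm_apply φ Z

/-- The right-hand side of the Koszul formula for left-invariant vector fields,
`Z ↦ (Q([X, Y], Z) - Q([Y, Z], X) + Q([Z, X], Y)) / 2`, as a linear functional of `Z`. -/
def koszul (Q : LinearMap.BilinForm ℝ s) (X Y : s) : Module.Dual ℝ s where
  toFun Z := (Q ⁅X, Y⁆ Z - Q ⁅Y, Z⁆ X + Q ⁅Z, X⁆ Y) / 2
  map_add' Z W := by
    simp only [lie_add, add_lie, map_add, LinearMap.add_apply]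
    ring
  map_smul' c Z := by
    simp only [lie_smul, smul_lie, map_smul, LinearMap.smul_apply, smul_eq_mul, RingHom.id_apply]
    ring

/-- The Levi-Civita connection of the left-invariant metric determined by `Q`, restricted to
left-invariant vector fields: `leviCivita Q hQ X Y` is `∇_X Y`, given by the Koszul formula. -/
def leviCivita (Q : LinearMap.BilinForm ℝ s) (hQ : IsInnerProduct Q) : s →ₗ[ℝ] Module.End ℝ s :=
  LinearMap.mk₂ ℝ (fun X Y => represent Q hQ (koszul Q X Y))
    (fun X X' Y => by
      rw [← map_add]; congr 1; ext Z
      simp only [koszul, LinearMap.coe_mk, AddHom.coe_mk, LinearMap.add_apply, lie_add, add_lie,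
        map_add]
      ring)
    (fun c X Y => by
      rw [← map_smul]; congr 1; ext Z
      simp only [koszul, LinearMap.coe_mk, AddHom.coe_mk, LinearMap.smul_apply, lie_smul, smul_lie,
        map_smul, smul_eq_mul]
      ring)
    (fun X Y Y' => by
      rw [← map_add]; congr 1; ext Z
      simp only [koszul, LinearMap.coe_mk, AddHom.coe_mk, LinearMap.add_apply, lie_add, add_lie,
        map_add]
      ring)
    (fun c X Y => by
      rw [← map_smul]; congr 1; ext Z
      simp only [koszul, LinearMap.coe_mk, AddHom.coe_mk, LinearMap.smul_apply, lie_smul, smul_lie,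
        map_smul, smul_eq_mul]
      ring)

theorem leviCivita_spec (Q : LinearMap.BilinForm ℝ s) (hQ : IsInnerProduct Q) (X Y Z : s) :
    Q (leviCivita Q hQ X Y) Z = (Q ⁅X, Y⁆ Z - Q ⁅Y, Z⁆ X + Q ⁅Z, X⁆ Y) / 2 :=
  represent_spec Q hQ (koszul Q X Y) Z

/-- The map `Z ↦ R(Z, X) Y`, where `R(Z, X) = ∇_Z ∇_X - ∇_X ∇_Z - ∇_[Z, X]` is the curvature
operator of the metric Lie algebra. -/
def curvatureMap (Q : LinearMap.BilinForm ℝ s) (hQ : IsInnerProduct Q) (X Y : s) :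
    Module.End ℝ s where
  toFun Z := leviCivita Q hQ Z (leviCivita Q hQ X Y) - leviCivita Q hQ X (leviCivita Q hQ Z Y)
    - leviCivita Q hQ ⁅Z, X⁆ Y
  map_add' Z W := by
    simp only [add_lie, map_add, LinearMap.add_apply]
    abel
  map_smul' c Z := by
    simp only [smul_lie, map_smul, LinearMap.smul_apply, smul_sub, RingHom.id_apply]

/-- The Ricci form `Ric(X, Y) = trace (Z ↦ R(Z, X) Y)`. -/
def ricciForm (Q : LinearMap.BilinForm ℝ s) (hQ : IsInnerProduct Q) : LinearMap.BilinForm ℝ s :=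
  LinearMap.mk₂ ℝ (fun X Y => LinearMap.trace ℝ s (curvatureMap Q hQ X Y))
    (fun X X' Y => by
      rw [← map_add]; congr 1; ext Z
      simp only [curvatureMap, LinearMap.coe_mk, AddHom.coe_mk, LinearMap.add_apply, lie_add,
        map_add]
      abel)
    (fun c X Y => by
      rw [← map_smul]; congr 1; ext Z
      simp only [curvatureMap, LinearMap.coe_mk, AddHom.coe_mk, LinearMap.smul_apply, lie_smul,
        map_smul, smul_sub])
    (fun X Y Y' => by
      rw [← map_add]; congr 1; ext Z
      simp only [curvatureMap, LinearMap.coe_mk, AddHom.coe_mk, LinearMap.add_apply, map_add]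
      abel)
    (fun c X Y => by
      rw [← map_smul]; congr 1; ext Z
      simp only [curvatureMap, LinearMap.coe_mk, AddHom.coe_mk, LinearMap.smul_apply, map_smul,
        smul_sub])

/-- The Ricci operator of the metric Lie algebra: `Q(Ric X, Y) = Ric(X, Y)`. -/
def ricciOperator (Q : LinearMap.BilinForm ℝ s) (hQ : IsInnerProduct Q) : Module.End ℝ s :=
  represent Q hQ ∘ₗ ricciForm Q hQ

theorem ricciOperator_spec (Q : LinearMap.BilinForm ℝ s) (hQ : IsInnerProduct Q) (X Y : s) :
    Q (ricciOperator Q hQ X) Y = ricciForm Q hQ X Y :=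
  represent_spec Q hQ (ricciForm Q hQ X) Y

/-- The number of negative eigenvalues of an operator, counted with multiplicity. -/
def negEigenvalueCount (T : Module.End ℝ s) : ℕ :=
  Multiset.countP (fun r : ℝ => r < 0) T.charpoly.roots

end MetricLie

end

/-! Let a be the orthogonal complement of [s, s] and H the vector representing X ↦ tr (ad X); H lies
in a because commutators are trace-free. On a, Ric(X, X) is -1/4 times the squared norm of `symAd Q
X`, so it is negative unless ad X is skew; ad H is not skew, since its trace is |H|² > 0.

If some X in a has no skew translate X - tH, then Ric is negative definite on the span of H and X.
Otherwise a is abelian, because a skew ad X with X in s kills a. Put k = -Ric(H, H) > 0 and M = ∑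
|[eᵢ, eⱼ]|² for an orthonormal basis (eⱼ) of [s, s]. Then ∑ Ric(eⱼ, eⱼ) = -M/4 - |H|²
(`sum_inr_ricciForm`) and ∑ Ric(H, eⱼ)² ≤ kM/4 (`sum_ricciForm_meanCurvature_sq_le`). The M terms
cancel: ∑ (k Ric(eⱼ, eⱼ) + Ric(H, eⱼ)²) ≤ -k|H|² < 0, so some eⱼ spans with H a plane on which Ric
is negative definite.

Solvability enters through Lie's theorem, which gives tr (ad Y ∘ ad Y) = 0 for Y in [s, s]. -/

/-! ### Trace forms of solvable Lie algebras -/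

theorem LinearMap.trace_eq_add_trace_mapQ_of_apply_eq_smul {K V : Type*} [Field K]
    [AddCommGroup V] [Module K V] [FiniteDimensional K V] (f : V →ₗ[K] V) {v : V} (hv : v ≠ 0)
    {c : K} (hf : f v = c • v) (W : Submodule K V) (hW : W = K ∙ v) (h : W ≤ W.comap f) :
    LinearMap.trace K V f = c + LinearMap.trace K (V ⧸ W) (W.mapQ W f h) := by
  obtain ⟨ψ, hψ⟩ : ∃ ψ : Module.Dual K V, ψ v = 1 := by
    obtain ⟨ψ, hψ⟩ := not_forall.mp (mt (Module.forall_dual_apply_eq_zero_iff K v).mp hv)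
    exact ⟨(ψ v)⁻¹ • ψ, by simp [hψ]⟩
  obtain ⟨σ, hσ⟩ := W.mkQ.exists_rightInverse_of_surjective W.range_mkQ
  have hσ' : ∀ u, W.mkQ (σ u) = u := fun u => LinearMap.congr_fun hσ u
  have hWv : W.mkQ v = 0 := by
    rw [← LinearMap.mem_ker, Submodule.ker_mkQ, hW]
    exact Submodule.mem_span_singleton_self v
  have hmem : ∀ u, ψ (u - σ (W.mkQ u)) • v = u - σ (W.mkQ u) := by
    intro u
    have hu : u - σ (W.mkQ u) ∈ W := by
      refine (Submodule.Quotient.mk_eq_zero W).mp (?_ : W.mkQ _ = 0)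
      rw [map_sub, hσ', sub_self]
    obtain ⟨a, ha⟩ := Submodule.mem_span_singleton.mp (hW.le hu)
    rw [← ha, map_smul, hψ, smul_eq_mul, mul_one]
  let φ : Module.Dual K V := ψ ∘ₗ (LinearMap.id - σ ∘ₗ W.mkQ)
  have hφ : φ v = 1 := by
    change ψ (v - σ (W.mkQ v)) = 1
    rw [hWv, map_zero, sub_zero, hψ]
  -- Split f along V = σ(V/W) ⊕ Kv: the second summand has rank at most one and trace c.
  have hdec : f = f ∘ₗ σ ∘ₗ W.mkQ + φ.smulRight (f v) := by
    ext u
    change f u = f (σ (W.mkQ u)) + ψ (u - σ (W.mkQ u)) • f v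
    rw [← map_smul, hmem, ← map_add, add_sub_cancel]
  have hquot : W.mkQ ∘ₗ f ∘ₗ σ = W.mapQ W f h := by
    ext u
    change W.mkQ (f (σ (W.mkQ u))) = W.mkQ (f u)
    rw [← sub_eq_zero, ← map_sub, ← map_sub, ← LinearMap.mem_ker, Submodule.ker_mkQ]
    refine h (?_ : _ ∈ W)
    refine (Submodule.Quotient.mk_eq_zero W).mp (?_ : W.mkQ _ = 0)
    rw [map_sub, hσ', sub_self]
  calc LinearMap.trace K V f
      = LinearMap.trace K V ((f ∘ₗ σ) ∘ₗ W.mkQ) + LinearMap.trace K V (φ.smulRight (f v)) := by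
        conv_lhs => rw [hdec, map_add]
        rfl
    _ = _ := by
        rw [LinearMap.trace_comp_comm', hquot, LinearMap.trace_smulRight, hf, map_smul, hφ,
          smul_eq_mul, mul_one, add_comm]

namespace LieModule

/-- Lie's theorem gives a common eigenvector v. It is killed by ⁅y, z⁆, so the trace is unchanged on
passing to M/Kv; induct on the dimension. -/
theorem traceForm_apply_lie_eq_zero_of_isSolvable_of_isAlgClosed {K L : Type*} [Field K]
    [CharZero K] [IsAlgClosed K] [LieRing L] [LieAlgebra K L] [LieAlgebra.IsSolvable L]
    (x y z : L) (n : ℕ) : ∀ (M : Type*) [AddCommGroup M] [Module K M] [LieRingModule L M]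
    [LieModule K L M] [FiniteDimensional K M], Module.finrank K M = n →
      traceForm K L M x ⁅y, z⁆ = 0 := by
  induction n with
  | zero =>
    intro M _ _ _ _ _ hM
    have := Module.finrank_zero_iff.mp hM
    have h0 : toEnd K L M x ∘ₗ toEnd K L M ⁅y, z⁆ = 0 := Subsingleton.elim _ _
    rw [traceForm_apply_apply, h0, map_zero]
  | succ n ih =>
    intro M _ _ _ _ _ hM
    have : Nontrivial M := Module.nontrivial_of_finrank_pos (R := K) (by omega)
    obtain ⟨χ, hχ⟩ := exists_nontrivial_weightSpace_of_isSolvable K L M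
    obtain ⟨⟨v, hv⟩, hv0⟩ := exists_ne (0 : weightSpace M χ)
    rw [mem_weightSpace] at hv
    have hv0 : v ≠ 0 := by simpa using hv0
    let W : LieSubmodule K L M :=
      { toSubmodule := K ∙ v
        lie_mem := by
          intro u w hw
          obtain ⟨a, rfl⟩ := Submodule.mem_span_singleton.mp hw
          refine Submodule.mem_span_singleton.mpr ⟨a * χ u, ?_⟩
          rw [lie_smul, hv, mul_smul] }
    have hyz : ⁅⁅y, z⁆, v⁆ = 0 := by
      rw [lie_lie, hv, hv, lie_smul, lie_smul, hv, hv, smul_comm, sub_self]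
    have hfin : Module.finrank K (M ⧸ W) = n := by
      have h1 := W.toSubmodule.finrank_quotient_add_finrank
      have h2 : Module.finrank K W.toSubmodule = 1 := finrank_span_singleton hv0
      have h3 : Module.finrank K (M ⧸ W) = Module.finrank K (M ⧸ W.toSubmodule) := rfl
      omega
    have key := ih (M ⧸ W) hfin
    rw [traceForm_apply_apply] at key ⊢
    have hle : W.toSubmodule ≤
        W.toSubmodule.comap (toEnd K L M x ∘ₗ toEnd K L M ⁅y, z⁆) := fun w hw =>
      W.lie_mem (W.lie_mem hw)
    rw [LinearMap.trace_eq_add_trace_mapQ_of_apply_eq_smul _ hv0 (c := 0) (by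
      rw [LinearMap.comp_apply, toEnd_apply_apply K L M ⁅y, z⁆ v, hyz, map_zero, zero_smul])
      W.toSubmodule rfl hle, zero_add, ← key]
    refine congrArg _ (LinearMap.ext fun u => ?_)
    obtain ⟨u, rfl⟩ := LieSubmodule.Quotient.surjective_mk' W u
    rfl

theorem traceForm_apply_lie_eq_zero_of_isSolvable {L M : Type*} [LieRing L] [LieAlgebra ℝ L]
    [LieAlgebra.IsSolvable L] [AddCommGroup M] [Module ℝ M] [LieRingModule L M] [LieModule ℝ L M]
    [FiniteDimensional ℝ M] (x y z : L) : traceForm ℝ L M x ⁅y, z⁆ = 0 := by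
  have h := traceForm_apply_lie_eq_zero_of_isSolvable_of_isAlgClosed (K := ℂ)
    (L := TensorProduct ℝ ℂ L) ((1 : ℂ) ⊗ₜ[ℝ] x) ((1 : ℂ) ⊗ₜ[ℝ] y) ((1 : ℂ) ⊗ₜ[ℝ] z) _
    (TensorProduct ℝ ℂ M) rfl
  rw [LieAlgebra.ExtendScalars.bracket_tmul, traceForm_baseChange] at h
  simpa using h

end LieModule
-- Adapted orthonormal bases and counting negative eigenvalues
noncomputable section

namespace MetricLie
variable {s : Type*} [AddCommGroup s] [Module ℝ s]

/-- The inner product space structure of a symmetric positive definite bilinear form. -/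
@[reducible]
def innerCore (Q : LinearMap.BilinForm ℝ s) (symm : ∀ X Y : s, Q X Y = Q Y X)
    (pos : ∀ X : s, X ≠ 0 → 0 < Q X X) : InnerProductSpace.Core ℝ s where
  inner X Y := Q X Y
  conj_inner_symm X Y := symm Y X
  re_inner_nonneg X := by
    by_cases h : X = 0
    · simp [h]
    · exact (pos X h).le
  add_left X Y Z := by simp
  smul_left X Y r := by simp
  definite X h := by
    by_contra hX
    exact (pos X hX).ne' h

variable [FiniteDimensional ℝ s] {Q : LinearMap.BilinForm ℝ s}

theorem exists_orthonormal_basis_adapted (symm : ∀ X Y : s, Q X Y = Q Y X)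
    (pos : ∀ X : s, X ≠ 0 → 0 < Q X X) (m : Submodule ℝ s) :
    ∃ (p q : ℕ) (b : Module.Basis (Fin p ⊕ Fin q) ℝ s),
      (∀ i j, Q (b i) (b j) = if i = j then 1 else 0) ∧
      (∀ k, ∀ Y ∈ m, Q (b (.inl k)) Y = 0) ∧ ∀ j, b (.inr j) ∈ m := by
  let core := innerCore Q symm pos
  let : NormedAddCommGroup s := core.toNormedAddCommGroup
  let : InnerProductSpace ℝ s := InnerProductSpace.ofCore core.toCore
  have hQ : ∀ X Y : s, Q X Y = inner ℝ X Y := fun _ _ => rfl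
  let ba := stdOrthonormalBasis ℝ mᗮ
  let bm := stdOrthonormalBasis ℝ m
  have hc : IsCompl mᗮ m := m.isCompl_orthogonal.symm
  let b := (ba.toBasis.prod bm.toBasis).map (Submodule.prodEquivOfIsCompl mᗮ m hc)
  have hl : ∀ k, b (.inl k) = ba k := fun k => by simp [b]
  have hr : ∀ k, b (.inr k) = bm k := fun k => by simp [b]
  refine ⟨_, _, b, ?_, ?_, ?_⟩
  · rintro (i | i) (j | j)
    · simpa [hQ, hl] using orthonormal_iff_ite.mp ba.orthonormal i j
    · simpa [hQ, hl, hr] using m.inner_left_of_mem_orthogonal (bm j).2 (ba i).2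
    · simpa [hQ, hl, hr] using m.inner_right_of_mem_orthogonal (bm i).2 (ba j).2
    · simpa [hQ, hr] using orthonormal_iff_ite.mp bm.orthonormal i j
  · intro k Y hY
    rw [hQ, hl]
    exact m.inner_left_of_mem_orthogonal hY (ba k).2
  · intro j
    rw [hr]
    exact (bm j).2

/-- With at most one negative eigenvalue, the plane would contain a nonzero combination orthogonal
to all negative eigenvectors, where the form is nonnegative. Independence of U and V is implicit in
`hneg`. -/
theorem two_le_negEigenvalueCount_aux (symm : ∀ X Y : s, Q X Y = Q Y X)
    (pos : ∀ X : s, X ≠ 0 → 0 < Q X X) (T : Module.End ℝ s)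
    (hT : ∀ X Y, Q (T X) Y = Q X (T Y)) (U V : s)
    (hneg : ∀ x y : ℝ, (x ≠ 0 ∨ y ≠ 0) → Q (T (x • U + y • V)) (x • U + y • V) < 0) :
    2 ≤ Multiset.countP (fun r : ℝ => r < 0) T.charpoly.roots := by
  let core := innerCore Q symm pos
  let : NormedAddCommGroup s := core.toNormedAddCommGroup
  let : InnerProductSpace ℝ s := InnerProductSpace.ofCore core.toCore
  have hQ : ∀ X Y : s, Q X Y = inner ℝ X Y := fun _ _ => rfl
  have hS : T.IsSymmetric := hT
  rw [hS.roots_charpoly_eq_eigenvalues rfl, Multiset.countP_map]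
  by_contra! hlt
  let e := hS.eigenvectorBasis rfl
  let N : Finset (Fin (Module.finrank ℝ s)) := Finset.univ.filter fun i => hS.eigenvalues rfl i < 0
  have hN : N.card ≤ 1 := Nat.lt_succ_iff.mp hlt
  obtain ⟨x, y, hxy, h0⟩ : ∃ x y : ℝ, (x ≠ 0 ∨ y ≠ 0) ∧
      ∀ i ∈ N, inner ℝ (e i) (x • U + y • V) = 0 := by
    rcases N.eq_empty_or_nonempty with hE | ⟨i, hi⟩
    · exact ⟨1, 0, by simp, by simp [hE]⟩
    · have hu : ∀ j ∈ N, j = i := fun j hj => Finset.card_le_one.mp hN j hj i hi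
      by_cases hUV : inner ℝ (e i) U = 0
      · exact ⟨1, 0, by simp, fun j hj => by rw [hu j hj]; simp [hUV]⟩
      · refine ⟨inner ℝ (e i) V, -inner ℝ (e i) U, Or.inr (by simpa using hUV), fun j hj => ?_⟩
        rw [hu j hj, inner_add_right, inner_smul_right, inner_smul_right]
        ring
  set W := x • U + y • V
  refine (hneg x y hxy).not_ge ?_
  change 0 ≤ Q (T W) W
  rw [hQ, ← e.sum_inner_mul_inner]
  refine Finset.sum_nonneg fun i _ => ?_
  have h1 : inner ℝ (T W) (e i) = hS.eigenvalues rfl i * inner ℝ W (e i) := by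
    rw [hS W (e i), hS.apply_eigenvectorBasis, inner_smul_right]
    rfl
  rw [h1]
  by_cases hi : i ∈ N
  · rw [h0 i hi, mul_zero]
  · have : 0 ≤ hS.eigenvalues rfl i := by simpa [N] using hi
    rw [real_inner_comm, mul_assoc]
    exact mul_nonneg this (mul_self_nonneg _)

end MetricLie
end
-- The Ricci form in an orthonormal basis
noncomputable section

namespace MetricLie

theorem bilin_eq_sum {V ι : Type*} [AddCommGroup V] [Module ℝ V] [Fintype ι]
    [DecidableEq ι] {Q : LinearMap.BilinForm ℝ V} {b : Module.Basis ι ℝ V}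
    (hb : ∀ i j, Q (b i) (b j) = if i = j then 1 else 0)
    (X Y : V) : Q X Y = ∑ i, Q X (b i) * Q Y (b i) := by
  have hr : ∀ Z i, b.repr Z i = Q Z (b i) := by
    intro Z i
    conv_rhs => rw [← b.sum_repr Z]
    simp [hb, -Module.Basis.sum_repr]
  conv_lhs => rw [← b.sum_repr Y]
  simp [hr, mul_comm]

theorem trace_eq_sum_bilin {V ι : Type*} [AddCommGroup V] [Module ℝ V] [Fintype ι]
    [DecidableEq ι] {Q : LinearMap.BilinForm ℝ V} {b : Module.Basis ι ℝ V}
    (hb : ∀ i j, Q (b i) (b j) = if i = j then 1 else 0) (f : Module.End ℝ V) :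
    LinearMap.trace ℝ V f = ∑ i, Q (f (b i)) (b i) := by
  have hr : ∀ Z i, b.repr Z i = Q Z (b i) := by
    intro Z i
    conv_rhs => rw [← b.sum_repr Z]
    simp [hb, -Module.Basis.sum_repr]
  simp [LinearMap.trace_eq_matrix_trace ℝ b, Matrix.trace, LinearMap.toMatrix_apply, hr]

variable {s : Type*} [LieRing s] [LieAlgebra ℝ s]

/-- The bilinear form `(U, V) ↦ Q([X, U], V) + Q([X, V], U)`, twice the `Q`-symmetric part
of `ad X`. -/
def symAd (Q : LinearMap.BilinForm ℝ s) (X U V : s) : ℝ := Q ⁅X, U⁆ V + Q ⁅X, V⁆ U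

theorem symAd_comm (Q : LinearMap.BilinForm ℝ s) (X U V : s) :
    symAd Q X U V = symAd Q X V U := add_comm _ _

theorem symAd_smul (Q : LinearMap.BilinForm ℝ s) (t : ℝ) (X U V : s) :
    symAd Q (t • X) U V = t * symAd Q X U V := by
  simp only [symAd, smul_lie, map_smul, LinearMap.smul_apply, smul_eq_mul]
  ring

theorem sum_sum_symm_mul_antisymm {ι : Type*} [Fintype ι] (f g : ι → ι → ℝ)
    (hf : ∀ i j, f i j = f j i) (hg : ∀ i j, g i j = -g j i) : ∑ i, ∑ j, f i j * g i j = 0 := by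
  have h : ∑ i, ∑ j, f i j * g i j = -∑ i, ∑ j, f i j * g i j := by
    conv_lhs => rw [Finset.sum_comm]
    simp only [← Finset.sum_neg_distrib]
    refine Finset.sum_congr rfl fun i _ => Finset.sum_congr rfl fun j _ => ?_
    rw [hf j i, hg j i]
    ring
  linarith

variable [FiniteDimensional ℝ s]

attribute [local instance] LieRing.ofAssociativeRing in
/-- The mean curvature vector: `Q (H, Z) = trace (ad Z)`. -/
def meanCurvature (Q : LinearMap.BilinForm ℝ s) (hQ : IsInnerProduct Q) : s :=
  represent Q hQ (LinearMap.trace ℝ s ∘ₗ (LieAlgebra.ad ℝ s).toLinearMap)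

theorem meanCurvature_spec (Q : LinearMap.BilinForm ℝ s) (hQ : IsInnerProduct Q) (Z : s) :
    Q (meanCurvature Q hQ) Z = LinearMap.trace ℝ s (LieAlgebra.ad ℝ s Z) :=
  represent_spec Q hQ _ Z

attribute [local instance] LieRing.ofAssociativeRing in
theorem meanCurvature_lie (Q : LinearMap.BilinForm ℝ s) (hQ : IsInnerProduct Q) (X Y : s) :
    Q (meanCurvature Q hQ) ⁅X, Y⁆ = 0 := by
  rw [meanCurvature_spec, LieHom.map_lie, LinearMap.trace_lie]

/-- Since each ∇_X is skew, the trace becomes a sum of products of first-order terms. The Koszul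
formula splits these into parts symmetric and antisymmetric in (i, j), and the mixed products
cancel. -/
theorem ricciForm_eq {ι : Type*} [Fintype ι] [DecidableEq ι] (Q : LinearMap.BilinForm ℝ s)
    (hQ : IsInnerProduct Q) (b : Module.Basis ι ℝ s)
    (hb : ∀ i j, Q (b i) (b j) = if i = j then 1 else 0) (X Y : s) :
    ricciForm Q hQ X Y = -(1 / 4) * ∑ i, ∑ j, symAd Q X (b i) (b j) * symAd Q Y (b i) (b j)
      + (1 / 4) * ∑ i, ∑ j, Q ⁅b i, b j⁆ X * Q ⁅b i, b j⁆ Y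
      - (1 / 2) * (Q ⁅meanCurvature Q hQ, X⁆ Y + Q ⁅meanCurvature Q hQ, Y⁆ X) := by
  set H := meanCurvature Q hQ with hH
  have htr : ∀ W : s, ∑ i, Q (leviCivita Q hQ (b i) W) (b i) = -Q H W := by
    intro W
    rw [meanCurvature_spec, trace_eq_sum_bilin hb, ← Finset.sum_neg_distrib]
    refine Finset.sum_congr rfl fun i _ => ?_
    rw [leviCivita_spec, lie_self, map_zero, LinearMap.zero_apply, ← lie_skew, LieAlgebra.ad_apply,
      map_neg, LinearMap.neg_apply]
    ring
  have hskew : ∀ X Y Z : s, Q (leviCivita Q hQ X Y) Z = -Q (leviCivita Q hQ X Z) Y := by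
    intro X Y Z
    rw [leviCivita_spec, leviCivita_spec, ← lie_skew Y Z, ← lie_skew Y X, ← lie_skew Z X]
    simp only [map_neg, LinearMap.neg_apply]
    ring
  have h1 : ricciForm Q hQ X Y = -Q H (leviCivita Q hQ X Y)
      + ∑ i, ∑ j, Q (leviCivita Q hQ (b i) Y) (b j) *
        (Q (leviCivita Q hQ X (b i)) (b j) + Q ⁅X, b j⁆ (b i)) := by
    change LinearMap.trace ℝ s (curvatureMap Q hQ X Y) = _
    rw [trace_eq_sum_bilin hb, ← htr]
    have h2 : ∀ i, Q (leviCivita Q hQ X (leviCivita Q hQ (b i) Y)) (b i) =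
        -∑ j, Q (leviCivita Q hQ (b i) Y) (b j) * Q (leviCivita Q hQ X (b i)) (b j) := by
      intro i
      rw [hskew, hQ.symm, bilin_eq_sum hb]
    have h3 : ∑ i, Q (leviCivita Q hQ ⁅b i, X⁆ Y) (b i) =
        -∑ i, ∑ j, Q (leviCivita Q hQ (b i) Y) (b j) * Q ⁅X, b j⁆ (b i) := by
      rw [Finset.sum_comm, ← Finset.sum_neg_distrib]
      refine Finset.sum_congr rfl fun i _ => ?_
      let g : Module.Dual ℝ s := (Q.flip (b i)) ∘ₗ (leviCivita Q hQ).flip Y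
      have hg : ∀ Z, g Z = Q (leviCivita Q hQ Z Y) (b i) := fun _ => rfl
      rw [← hg, ← represent_spec Q hQ g, bilin_eq_sum hb, ← Finset.sum_neg_distrib]
      refine Finset.sum_congr rfl fun j _ => ?_
      rw [represent_spec, hg, ← lie_skew (b i) X, map_neg, LinearMap.neg_apply, mul_neg]
    simp only [curvatureMap, LinearMap.coe_mk, AddHom.coe_mk, map_sub, LinearMap.sub_apply,
      Finset.sum_sub_distrib, mul_add, Finset.sum_add_distrib]
    rw [h3, Finset.sum_congr rfl fun i _ => h2 i, Finset.sum_neg_distrib]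
    ring
  have h4 : ∀ i j, Q (leviCivita Q hQ (b i) Y) (b j) *
        (Q (leviCivita Q hQ X (b i)) (b j) + Q ⁅X, b j⁆ (b i)) =
      -(1 / 4) * (symAd Q X (b i) (b j) * symAd Q Y (b i) (b j))
      + (1 / 4) * (Q ⁅b i, b j⁆ X * Q ⁅b i, b j⁆ Y)
      + (1 / 4) * (symAd Q Y (b i) (b j) * Q ⁅b i, b j⁆ X)
      + -(1 / 4) * (symAd Q X (b i) (b j) * Q ⁅b i, b j⁆ Y) := by
    intro i j
    rw [leviCivita_spec, leviCivita_spec, ← lie_skew (b i) Y, ← lie_skew (b j) (b i),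
      ← lie_skew (b j) X]
    simp only [symAd, map_neg, LinearMap.neg_apply]
    ring
  have hanti : ∀ W : s, ∀ i j, Q ⁅b i, b j⁆ W = -Q ⁅b j, b i⁆ W := by
    intro W i j
    rw [← lie_skew, map_neg, LinearMap.neg_apply]
  have h5 : Q H (leviCivita Q hQ X Y) = (1 / 2) * (Q ⁅H, X⁆ Y + Q ⁅H, Y⁆ X) := by
    rw [hQ.symm, leviCivita_spec, hQ.symm ⁅X, Y⁆, hH, meanCurvature_lie,
      ← lie_skew Y]
    simp only [map_neg, LinearMap.neg_apply]
    ring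
  rw [h1, h5]
  simp only [h4, Finset.sum_add_distrib, ← Finset.mul_sum]
  rw [sum_sum_symm_mul_antisymm _ _ (fun i j => symAd_comm Q Y (b i) (b j)) (hanti X),
    sum_sum_symm_mul_antisymm _ _ (fun i j => symAd_comm Q X (b i) (b j)) (hanti Y)]
  ring

end MetricLie
end
-- An antisymmetric matrix inequality; Ricci on the complement of [s, s]
noncomputable section

namespace MetricLie

theorem two_mul_sum_sq_le_of_antisymm {ι : Type*} [Fintype ι] (v : ι → ℝ) (P : ι → ι → ℝ)
    (hP : ∀ i j, P i j = -P j i) :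
    2 * ∑ j, (∑ i, v i * P i j) ^ 2 ≤ (∑ i, v i ^ 2) * ∑ i, ∑ j, P i j ^ 2 := by
  set n := ∑ i, v i ^ 2 with hn
  set w : ι → ℝ := fun j => ∑ i, v i * P i j with hw
  have hn0 : 0 ≤ n := Finset.sum_nonneg fun i _ => sq_nonneg _
  rcases hn0.eq_or_lt with h0 | hpos
  · have hv : ∀ i, v i = 0 := fun i => by
      have := (Finset.sum_eq_zero_iff_of_nonneg fun i _ => sq_nonneg (v i)).mp h0.symm i
        (Finset.mem_univ i)
      exact pow_eq_zero_iff two_ne_zero |>.mp this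
    simp [hv, ← h0]
  have e1 : ∑ i, ∑ j, P i j * (v i * w j) = ∑ j, w j ^ 2 := by
    rw [Finset.sum_comm]
    refine Finset.sum_congr rfl fun j _ => ?_
    rw [sq]
    conv_rhs => rw [hw, Finset.sum_mul]
    exact Finset.sum_congr rfl fun i _ => by ring
  have e2 : ∑ i, ∑ j, P i j * (w i * v j) = -∑ j, w j ^ 2 := by
    rw [← Finset.sum_neg_distrib]
    refine Finset.sum_congr rfl fun i _ => ?_
    rw [sq]
    conv_rhs => rw [hw, Finset.sum_mul, ← Finset.sum_neg_distrib]
    refine Finset.sum_congr rfl fun j _ => ?_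
    rw [hP i j]
    ring
  have e3 : ∑ i, ∑ j, (v i * w j) ^ 2 = n * ∑ j, w j ^ 2 := by
    simp only [mul_pow, ← Finset.mul_sum, ← Finset.sum_mul, hn]
  have e4 : ∑ i, ∑ j, (w i * v j) ^ 2 = n * ∑ j, w j ^ 2 := by
    simp only [mul_pow, ← Finset.mul_sum, ← Finset.sum_mul, hn]
    ring
  have e5 : ∑ i, ∑ j, (v i * w j) * (w i * v j) = (∑ i, v i * w i) ^ 2 := by
    rw [sq, Finset.sum_mul_sum]
    exact Finset.sum_congr rfl fun i _ => Finset.sum_congr rfl fun j _ => by ring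
  -- The inequality is nonnegativity of this square: n P minus v ∧ w, where w = vP.
  have key : ∑ i, ∑ j, (n * P i j - v i * w j + w i * v j) ^ 2 =
      n ^ 2 * ∑ i, ∑ j, P i j ^ 2 + ∑ i, ∑ j, (v i * w j) ^ 2 + ∑ i, ∑ j, (w i * v j) ^ 2
      - 2 * n * ∑ i, ∑ j, P i j * (v i * w j) + 2 * n * ∑ i, ∑ j, P i j * (w i * v j)
      - 2 * ∑ i, ∑ j, (v i * w j) * (w i * v j) := by
    simp only [Finset.mul_sum, ← Finset.sum_add_distrib, ← Finset.sum_sub_distrib]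
    exact Finset.sum_congr rfl fun i _ => Finset.sum_congr rfl fun j _ => by ring
  have h0 : 0 ≤ ∑ i, ∑ j, (n * P i j - v i * w j + w i * v j) ^ 2 :=
    Finset.sum_nonneg fun i _ => Finset.sum_nonneg fun j _ => sq_nonneg _
  rw [key, e1, e2, e3, e4, e5] at h0
  refine le_of_mul_le_mul_left ?_ hpos
  nlinarith [sq_nonneg (∑ i, v i * w i)]

variable {s : Type*} [LieRing s] [LieAlgebra ℝ s]

/-- The linear span of all brackets. -/
def bracketSpan (s : Type*) [LieRing s] [LieAlgebra ℝ s] : Submodule ℝ s :=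
  Submodule.span ℝ {Z | ∃ X Y : s, ⁅X, Y⁆ = Z}

theorem lie_mem_bracketSpan (X Y : s) : ⁅X, Y⁆ ∈ bracketSpan s :=
  Submodule.subset_span ⟨X, Y, rfl⟩

theorem eq_zero_on_bracketSpan {f : Module.Dual ℝ s} (h : ∀ X Y : s, f ⁅X, Y⁆ = 0) {Z : s}
    (hZ : Z ∈ bracketSpan s) : f Z = 0 := by
  have : bracketSpan s ≤ LinearMap.ker f := Submodule.span_le.mpr <| by
    rintro _ ⟨X, Y, rfl⟩
    exact h X Y
  exact this hZ

/-- The orthogonal complement of the derived algebra. -/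
def bracketOrthogonal (Q : LinearMap.BilinForm ℝ s) : Submodule ℝ s where
  carrier := {X | ∀ Y Z : s, Q X ⁅Y, Z⁆ = 0}
  add_mem' hX hX' Y Z := by simp [hX Y Z, hX' Y Z]
  zero_mem' Y Z := by simp
  smul_mem' c X hX Y Z := by simp [hX Y Z]

/-- `ad X` is skew-adjoint with respect to `Q`. -/
def IsSkewAd (Q : LinearMap.BilinForm ℝ s) (X : s) : Prop := ∀ U V : s, symAd Q X U V = 0

theorem isSkewAd_of_basis {ι : Type*} {Q : LinearMap.BilinForm ℝ s} (b : Module.Basis ι ℝ s)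
    {X : s} (h : ∀ i j, symAd Q X (b i) (b j) = 0) : IsSkewAd Q X := by
  let f : LinearMap.BilinForm ℝ s := Q ∘ₗ (LieModule.toEnd ℝ s s X)
  have hf : f + f.flip = 0 := b.ext fun i => b.ext fun j => h i j
  intro U V
  exact LinearMap.congr_fun (LinearMap.congr_fun hf U) V

theorem IsSkewAd.smul {Q : LinearMap.BilinForm ℝ s} {X : s} (h : IsSkewAd Q X) (t : ℝ) :
    IsSkewAd Q (t • X) := fun U V => by rw [symAd_smul, h U V, mul_zero]

theorem lie_eq_zero_of_isSkewAd {Q : LinearMap.BilinForm ℝ s} (hQ : IsInnerProduct Q) {X Y : s}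
    (hX : IsSkewAd Q X) (hY : Y ∈ bracketOrthogonal Q) : ⁅X, Y⁆ = 0 := by
  by_contra h
  -- Skewness gives |[X, Y]|² = -Q([X, [X, Y]], Y), which vanishes as Y is orthogonal to brackets.
  have h1 := hX Y ⁅X, Y⁆
  rw [symAd, hQ.symm ⁅X, ⁅X, Y⁆⁆, hY X ⁅X, Y⁆, add_zero] at h1
  exact (hQ.pos _ h).ne' h1

theorem lie_eq_zero_of_forall_exists_isSkewAd {Q : LinearMap.BilinForm ℝ s}
    (hQ : IsInnerProduct Q) {H : s}
    (hH : H ∈ bracketOrthogonal Q)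
    (h : ∀ X ∈ bracketOrthogonal Q, ∃ t : ℝ, IsSkewAd Q (X - t • H)) {X Y : s}
    (hX : X ∈ bracketOrthogonal Q) (hY : Y ∈ bracketOrthogonal Q) : ⁅X, Y⁆ = 0 := by
  have hXH : ∀ Z ∈ bracketOrthogonal Q, ⁅Z, H⁆ = 0 := by
    intro Z hZ
    obtain ⟨t, ht⟩ := h Z hZ
    simpa using lie_eq_zero_of_isSkewAd hQ ht hH
  obtain ⟨t, ht⟩ := h X hX
  have h1 := lie_eq_zero_of_isSkewAd hQ ht hY
  rw [sub_lie, smul_lie, ← lie_skew H Y, hXH Y hY] at h1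
  simpa using h1

variable [FiniteDimensional ℝ s] {Q : LinearMap.BilinForm ℝ s}

theorem exists_bracket_adapted_basis (hQ : IsInnerProduct Q) :
    ∃ (p q : ℕ) (b : Module.Basis (Fin p ⊕ Fin q) ℝ s),
      (∀ i j, Q (b i) (b j) = if i = j then 1 else 0) ∧
      (∀ k, b (.inl k) ∈ bracketOrthogonal Q) ∧ ∀ j, b (.inr j) ∈ bracketSpan s := by
  obtain ⟨p, q, b, h1, h2, h3⟩ := exists_orthonormal_basis_adapted hQ.symm hQ.pos (bracketSpan s)
  exact ⟨p, q, b, h1, fun k Y Z => h2 k _ (lie_mem_bracketSpan Y Z), h3⟩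

theorem two_le_negEigenvalueCount (hQ : IsInnerProduct Q) (U V : s)
    (hneg : ∀ x y : ℝ, (x ≠ 0 ∨ y ≠ 0) →
      ricciForm Q hQ (x • U + y • V) (x • U + y • V) < 0) :
    2 ≤ negEigenvalueCount (ricciOperator Q hQ) := by
  refine two_le_negEigenvalueCount_aux hQ.symm hQ.pos _ (fun X Y => ?_) U V fun x y hxy => ?_
  · obtain ⟨p, q, b, hb, -⟩ := exists_bracket_adapted_basis hQ
    rw [hQ.symm X, ricciOperator_spec, ricciOperator_spec, ricciForm_eq Q hQ b hb,
      ricciForm_eq Q hQ b hb]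
    simp only [mul_comm (symAd Q X _ _), mul_comm (Q _ X), add_comm (Q ⁅_, X⁆ Y)]
  · rw [ricciOperator_spec]
    exact hneg x y hxy

theorem meanCurvature_mem (hQ : IsInnerProduct Q) :
    meanCurvature Q hQ ∈ bracketOrthogonal Q := meanCurvature_lie Q hQ

theorem ricciForm_of_mem_orthogonal {ι : Type*} [Fintype ι] [DecidableEq ι]
    (hQ : IsInnerProduct Q) (b : Module.Basis ι ℝ s)
    (hb : ∀ i j, Q (b i) (b j) = if i = j then 1 else 0) {X : s} (hX : X ∈ bracketOrthogonal Q) :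
    ricciForm Q hQ X X = -(1 / 4) * ∑ i, ∑ j, symAd Q X (b i) (b j) ^ 2 := by
  have h : ∀ U V : s, Q ⁅U, V⁆ X = 0 := fun U V => (hQ.symm _ _).trans (hX U V)
  rw [ricciForm_eq Q hQ b hb]
  simp [h, sq]

theorem ricciForm_neg_of_not_isSkewAd (hQ : IsInnerProduct Q) {X : s}
    (hX : X ∈ bracketOrthogonal Q) (h : ¬IsSkewAd Q X) : ricciForm Q hQ X X < 0 := by
  obtain ⟨p, q, b, hb, -⟩ := exists_bracket_adapted_basis hQ
  rw [ricciForm_of_mem_orthogonal hQ b hb hX]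
  have h0 : 0 ≤ ∑ i, ∑ j, symAd Q X (b i) (b j) ^ 2 :=
    Finset.sum_nonneg fun i _ => Finset.sum_nonneg fun j _ => sq_nonneg _
  rcases h0.eq_or_lt with h0 | h0
  · refine (h (isSkewAd_of_basis b fun i j => ?_)).elim
    have h1 := (Finset.sum_eq_zero_iff_of_nonneg fun i _ =>
      Finset.sum_nonneg fun j _ => sq_nonneg _).mp h0.symm i (Finset.mem_univ i)
    have h2 := (Finset.sum_eq_zero_iff_of_nonneg fun j _ => sq_nonneg _).mp h1 j
      (Finset.mem_univ j)
    exact pow_eq_zero_iff two_ne_zero |>.mp h2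
  · linarith

theorem not_isSkewAd_meanCurvature (hQ : IsInnerProduct Q) (hs : ¬IsUnimodular s) :
    0 < Q (meanCurvature Q hQ) (meanCurvature Q hQ) ∧ ¬IsSkewAd Q (meanCurvature Q hQ) := by
  have hH : meanCurvature Q hQ ≠ 0 := by
    intro h
    refine hs fun X => ?_
    rw [← meanCurvature_spec Q hQ X, h, map_zero, LinearMap.zero_apply]
  have hpos := hQ.pos _ hH
  refine ⟨hpos, fun hskew => hpos.ne' ?_⟩
  obtain ⟨p, q, b, hb, -⟩ := exists_bracket_adapted_basis hQ
  rw [meanCurvature_spec, trace_eq_sum_bilin hb]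
  refine Finset.sum_eq_zero fun i _ => ?_
  have := hskew (b i) (b i)
  rw [symAd] at this
  rw [LieAlgebra.ad_apply]
  linarith

/-- The Ricci form is negative definite on a plane if its Gram determinant there is positive and
it is negative on one vector. -/
theorem two_le_negEigenvalueCount_of_det (hQ : IsInnerProduct Q) (H E : s)
    (hH : ricciForm Q hQ H H < 0)
    (hE : -ricciForm Q hQ H H * ricciForm Q hQ E E + ricciForm Q hQ H E ^ 2 < 0) :
    2 ≤ negEigenvalueCount (ricciOperator Q hQ) := by
  refine two_le_negEigenvalueCount hQ H E fun x y hxy => ?_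
  have hsymm : ricciForm Q hQ E H = ricciForm Q hQ H E := by
    obtain ⟨p, q, b, hb, -⟩ := exists_bracket_adapted_basis hQ
    rw [ricciForm_eq Q hQ b hb, ricciForm_eq Q hQ b hb]
    simp only [mul_comm (symAd Q E _ _), mul_comm (Q _ E), add_comm (Q ⁅_, E⁆ H)]
  have hexp : ricciForm Q hQ (x • H + y • E) (x • H + y • E) =
      x ^ 2 * ricciForm Q hQ H H + 2 * x * y * ricciForm Q hQ H E
        + y ^ 2 * ricciForm Q hQ E E := by
    simp only [map_add, map_smul, LinearMap.add_apply, LinearMap.smul_apply, smul_eq_mul, hsymm]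
    ring
  rw [hexp]
  set k := ricciForm Q hQ H H
  set r := ricciForm Q hQ H E
  set c := ricciForm Q hQ E E
  by_cases hy : y = 0
  · have hx : 0 < x ^ 2 := by
      have : x ≠ 0 := by simpa [hy] using hxy
      positivity
    rw [hy]
    nlinarith
  · have hy : 0 < y ^ 2 := by positivity
    -- Complete the square: k times the form is (kx + ry)² + (kc - r²)y² > 0, and k < 0.
    nlinarith [sq_nonneg (k * x + y * r)]

end MetricLie
end
-- Ricci estimates on [s, s] when its complement is abelian
noncomputable section

namespace MetricLie

variable {s : Type*} [LieRing s] [LieAlgebra ℝ s] {Q : LinearMap.BilinForm ℝ s}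

theorem sum_bilin_lie_sq
    {p q : ℕ} (b : Module.Basis (Fin p ⊕ Fin q) ℝ s)
    (hb : ∀ i j, Q (b i) (b j) = if i = j then 1 else 0)
    (hQ : IsInnerProduct Q) (ha : ∀ k, b (.inl k) ∈ bracketOrthogonal Q) (X Y : s) :
    ∑ j, Q ⁅X, Y⁆ (b (.inr j)) ^ 2 = Q ⁅X, Y⁆ ⁅X, Y⁆ := by
  rw [bilin_eq_sum hb, Fintype.sum_sum_type]
  have : ∀ k, Q ⁅X, Y⁆ (b (.inl k)) = 0 := fun k => (hQ.symm _ _).trans (ha k X Y)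
  simp [this, sq]

variable [FiniteDimensional ℝ s]

theorem traceForm_eq_zero_of_mem_bracketSpan [LieAlgebra.IsSolvable s] (X : s) {Y : s}
    (hY : Y ∈ bracketSpan s) : LieModule.traceForm ℝ s s X Y = 0 :=
  eq_zero_on_bracketSpan
    (fun U V => LieModule.traceForm_apply_lie_eq_zero_of_isSolvable X U V) hY

/-- The cross term of the expanded square is tr (ad Y ∘ ad Y), zero by solvability. -/
theorem sum_symAd_sq [LieAlgebra.IsSolvable s] {ι : Type*} [Fintype ι] [DecidableEq ι]
    (b : Module.Basis ι ℝ s) (hb : ∀ i j, Q (b i) (b j) = if i = j then 1 else 0)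
    (hQ : IsInnerProduct Q) {Y : s} (hY : Y ∈ bracketSpan s) :
    ∑ i, ∑ j, symAd Q Y (b i) (b j) ^ 2 = 2 * ∑ i, Q ⁅Y, b i⁆ ⁅Y, b i⁆ := by
  have h1 : ∑ i, ∑ j, Q ⁅Y, b i⁆ (b j) * Q ⁅Y, b j⁆ (b i) = 0 := by
    rw [← traceForm_eq_zero_of_mem_bracketSpan Y hY, LieModule.traceForm_apply_apply,
      trace_eq_sum_bilin hb]
    refine Finset.sum_congr rfl fun i _ => ?_
    let g : Module.Dual ℝ s := Q.flip (b i) ∘ₗ LieModule.toEnd ℝ s s Y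
    have hg : ∀ Z, g Z = Q ⁅Y, Z⁆ (b i) := fun _ => rfl
    change _ = g ⁅Y, b i⁆
    rw [← represent_spec Q hQ g, bilin_eq_sum hb]
    refine Finset.sum_congr rfl fun j _ => ?_
    rw [represent_spec, hg, mul_comm]
  have h2 : ∀ i, Q ⁅Y, b i⁆ ⁅Y, b i⁆ = ∑ j, Q ⁅Y, b i⁆ (b j) ^ 2 := fun i => by
    rw [bilin_eq_sum hb]
    simp only [sq]
  have h3 : ∑ i, ∑ j, Q ⁅Y, b j⁆ (b i) ^ 2 = ∑ i, ∑ j, Q ⁅Y, b i⁆ (b j) ^ 2 :=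
    Finset.sum_comm
  simp only [symAd, add_sq, Finset.sum_add_distrib, mul_assoc, ← Finset.mul_sum, h1, h2, h3]
  ring

variable {p q : ℕ} (b : Module.Basis (Fin p ⊕ Fin q) ℝ s)

theorem sum_inr_symAd_sq [LieAlgebra.IsSolvable s]
    (hb : ∀ i j, Q (b i) (b j) = if i = j then 1 else 0)
    (hQ : IsInnerProduct Q) (ha : ∀ k, b (.inl k) ∈ bracketOrthogonal Q) {Y : s}
    (hY : Y ∈ bracketSpan s) :
    ∑ i, ∑ j, symAd Q Y (b (.inr i)) (b (.inr j)) ^ 2 =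
      2 * ∑ j, Q ⁅Y, b (.inr j)⁆ ⁅Y, b (.inr j)⁆ := by
  have h := sum_symAd_sq b hb hQ hY
  have h0 : ∀ k U, Q ⁅Y, U⁆ (b (.inl k)) = 0 := fun k U => (hQ.symm _ _).trans (ha k Y U)
  have h1 : ∑ k, ∑ j, symAd Q Y (b (.inl k)) (b (.inr j)) ^ 2 =
      ∑ k, Q ⁅Y, b (.inl k)⁆ ⁅Y, b (.inl k)⁆ := by
    refine Finset.sum_congr rfl fun k _ => ?_
    rw [← sum_bilin_lie_sq b hb hQ ha]
    simp [symAd, h0]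
  have h2 : ∑ j, ∑ k, symAd Q Y (b (.inr j)) (b (.inl k)) ^ 2 =
      ∑ k, Q ⁅Y, b (.inl k)⁆ ⁅Y, b (.inl k)⁆ := by
    rw [← h1, Finset.sum_comm]
    simp only [symAd_comm Q Y (b (.inr _))]
  have h3 : ∑ k, ∑ l, symAd Q Y (b (.inl k)) (b (.inl l)) ^ 2 = 0 := by
    simp [symAd, h0]
  simp only [Fintype.sum_sum_type, Finset.sum_add_distrib] at h
  linarith

theorem sum_inr_ricciForm [LieAlgebra.IsSolvable s]
    (hb : ∀ i j, Q (b i) (b j) = if i = j then 1 else 0)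
    (hQ : IsInnerProduct Q) (ha : ∀ k, b (.inl k) ∈ bracketOrthogonal Q)
    (hm : ∀ j, b (.inr j) ∈ bracketSpan s)
    (haa : ∀ X ∈ bracketOrthogonal Q, ∀ Y ∈ bracketOrthogonal Q, ⁅X, Y⁆ = 0) :
    ∑ j, ricciForm Q hQ (b (.inr j)) (b (.inr j)) =
      -(1 / 4) * ∑ i, ∑ j, Q ⁅b (.inr i), b (.inr j)⁆ ⁅b (.inr i), b (.inr j)⁆
        - Q (meanCurvature Q hQ) (meanCurvature Q hQ) := by
  set H := meanCurvature Q hQ with hH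
  have h1 : ∀ j, ricciForm Q hQ (b (.inr j)) (b (.inr j)) =
      -(1 / 2) * (∑ k, Q ⁅b (.inr j), b (.inl k)⁆ ⁅b (.inr j), b (.inl k)⁆
        + ∑ i, Q ⁅b (.inr j), b (.inr i)⁆ ⁅b (.inr j), b (.inr i)⁆)
      + (1 / 4) * ∑ i, ∑ i', Q ⁅b i, b i'⁆ (b (.inr j)) ^ 2
      - Q ⁅H, b (.inr j)⁆ (b (.inr j)) := by
    intro j
    have h := sum_symAd_sq b hb hQ (hm j)
    rw [Fintype.sum_sum_type (fun i => Q ⁅b (.inr j), b i⁆ ⁅b (.inr j), b i⁆)] at h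
    rw [ricciForm_eq Q hQ b hb]
    simp only [← sq]
    rw [h, ← hH]
    ring
  have h2 : ∑ j, ∑ i, ∑ i', Q ⁅b i, b i'⁆ (b (.inr j)) ^ 2 =
      2 * ∑ j, ∑ k, Q ⁅b (.inr j), b (.inl k)⁆ ⁅b (.inr j), b (.inl k)⁆
        + ∑ i, ∑ j, Q ⁅b (.inr i), b (.inr j)⁆ ⁅b (.inr i), b (.inr j)⁆ := by
    have e1 : ∑ j, ∑ i, ∑ i', Q ⁅b i, b i'⁆ (b (.inr j)) ^ 2 =
        ∑ i, ∑ i', Q ⁅b i, b i'⁆ ⁅b i, b i'⁆ := by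
      rw [Finset.sum_comm]
      refine Finset.sum_congr rfl fun i _ => ?_
      rw [Finset.sum_comm]
      exact Finset.sum_congr rfl fun i' _ => sum_bilin_lie_sq b hb hQ ha _ _
    have e2 : ∑ k, ∑ j, Q ⁅b (.inl k), b (.inr j)⁆ ⁅b (.inl k), b (.inr j)⁆ =
        ∑ j, ∑ k, Q ⁅b (.inr j), b (.inl k)⁆ ⁅b (.inr j), b (.inl k)⁆ := by
      rw [Finset.sum_comm]
      refine Finset.sum_congr rfl fun j _ => Finset.sum_congr rfl fun k _ => ?_
      rw [← lie_skew (b (.inl k))]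
      simp only [map_neg, LinearMap.neg_apply, neg_neg]
    have e3 : ∑ k, ∑ l, Q ⁅b (.inl k), b (.inl l)⁆ ⁅b (.inl k), b (.inl l)⁆ = 0 := by
      simp [haa _ (ha _) _ (ha _)]
    rw [e1]
    simp only [Fintype.sum_sum_type, Finset.sum_add_distrib]
    rw [e2, e3]
    ring
  -- This is tr (ad H): the complement contributes nothing, being abelian.
  have h3 : ∑ j, Q ⁅H, b (.inr j)⁆ (b (.inr j)) = Q H H := by
    rw [hH, meanCurvature_spec, trace_eq_sum_bilin hb, Fintype.sum_sum_type]
    simp [haa _ (meanCurvature_mem hQ) _ (ha _)]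
  simp only [h1, Finset.sum_sub_distrib, Finset.sum_add_distrib, ← Finset.mul_sum]
  rw [h2, h3]
  ring

theorem ricciForm_meanCurvature
    (hb : ∀ i j, Q (b i) (b j) = if i = j then 1 else 0)
    (hQ : IsInnerProduct Q) (ha : ∀ k, b (.inl k) ∈ bracketOrthogonal Q)
    (haa : ∀ X ∈ bracketOrthogonal Q, ∀ Y ∈ bracketOrthogonal Q, ⁅X, Y⁆ = 0) (Y : s) :
    ricciForm Q hQ (meanCurvature Q hQ) Y = -(1 / 4) * ∑ i, ∑ j,
      symAd Q (meanCurvature Q hQ) (b (.inr i)) (b (.inr j)) *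
        symAd Q Y (b (.inr i)) (b (.inr j)) := by
  set H := meanCurvature Q hQ with hH
  have hmem : H ∈ bracketOrthogonal Q := meanCurvature_mem hQ
  have h0 : ∀ U V : s, Q ⁅U, V⁆ H = 0 := fun U V => (hQ.symm _ _).trans (hmem U V)
  have h1 : ∀ k U, symAd Q H (b (.inl k)) U = 0 := by
    intro k U
    rw [symAd, haa _ hmem _ (ha k), hQ.symm ⁅H, U⁆, ha k H U]
    simp
  have h2 : ∀ k U, symAd Q H U (b (.inl k)) = 0 := fun k U => by rw [symAd_comm, h1]
  rw [ricciForm_eq Q hQ b hb, ← hH]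
  simp [Fintype.sum_sum_type, h0, h1, h2]

/-- Cauchy–Schwarz bounds Ric(H, v)² by the norms of `symAd Q H` and `symAd Q v` on [s, s]; the
latter is 2 ∑ |[v, eⱼ]|² ≤ |v|² M by `two_mul_sum_sq_le_of_antisymm`. -/
theorem sum_ricciForm_meanCurvature_sq_le [LieAlgebra.IsSolvable s]
    (hb : ∀ i j, Q (b i) (b j) = if i = j then 1 else 0)
    (hQ : IsInnerProduct Q) (ha : ∀ k, b (.inl k) ∈ bracketOrthogonal Q)
    (hm : ∀ j, b (.inr j) ∈ bracketSpan s)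
    (haa : ∀ X ∈ bracketOrthogonal Q, ∀ Y ∈ bracketOrthogonal Q, ⁅X, Y⁆ = 0) :
    ∑ j, ricciForm Q hQ (meanCurvature Q hQ) (b (.inr j)) ^ 2 ≤
      (1 / 4) * -ricciForm Q hQ (meanCurvature Q hQ) (meanCurvature Q hQ) *
        ∑ i, ∑ j, Q ⁅b (.inr i), b (.inr j)⁆ ⁅b (.inr i), b (.inr j)⁆ := by
  set H := meanCurvature Q hQ with hH
  set M := ∑ i, ∑ j, Q ⁅b (.inr i), b (.inr j)⁆ ⁅b (.inr i), b (.inr j)⁆ with hM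
  set c : Fin q → ℝ := fun j => ricciForm Q hQ H (b (.inr j)) with hc
  -- Chosen so that Ric(H, v) = |c|², the sum to be bounded; one factor |c|² is cancelled at the
  -- end.
  set v : s := ∑ j, c j • b (.inr j) with hv
  have hvm : v ∈ bracketSpan s :=
    Submodule.sum_mem _ fun j _ => Submodule.smul_mem _ _ (hm j)
  have hN : ricciForm Q hQ H v = ∑ j, c j ^ 2 := by
    simp only [hv, map_sum, map_smul, smul_eq_mul, hc, sq]
  have hK : -ricciForm Q hQ H H =
      (1 / 4) * ∑ i, ∑ j, symAd Q H (b (.inr i)) (b (.inr j)) ^ 2 := by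
    rw [hH, ricciForm_meanCurvature b hb hQ ha haa]
    simp only [sq]
    ring
  have hcs : ricciForm Q hQ H v ^ 2 ≤ (1 / 4) * -ricciForm Q hQ H H *
      ∑ i, ∑ j, symAd Q v (b (.inr i)) (b (.inr j)) ^ 2 := by
    rw [hK, hH, ricciForm_meanCurvature b hb hQ ha haa, ← hH]
    have := Finset.sum_mul_sq_le_sq_mul_sq (Finset.univ : Finset (Fin q × Fin q))
      (fun x => symAd Q H (b (.inr x.1)) (b (.inr x.2)))
      (fun x => symAd Q v (b (.inr x.1)) (b (.inr x.2)))
    simp only [Fintype.sum_prod_type] at this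
    nlinarith
  have hanti : 2 * ∑ j, Q ⁅v, b (.inr j)⁆ ⁅v, b (.inr j)⁆ ≤ (∑ j, c j ^ 2) * M := by
    have h1 : ∀ l, 2 * ∑ j, Q ⁅v, b (.inr j)⁆ (b (.inr l)) ^ 2 ≤
        (∑ j, c j ^ 2) * ∑ i, ∑ j, Q ⁅b (.inr i), b (.inr j)⁆ (b (.inr l)) ^ 2 := by
      intro l
      have := two_mul_sum_sq_le_of_antisymm c
        (fun i j => Q ⁅b (.inr i), b (.inr j)⁆ (b (.inr l)))
        (fun i j => by rw [← lie_skew, map_neg, LinearMap.neg_apply])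
      simpa [hv, sum_lie] using this
    have h2 := Finset.sum_le_sum fun l (_ : l ∈ Finset.univ) => h1 l
    rw [← Finset.mul_sum, ← Finset.mul_sum, Finset.sum_comm] at h2
    simp only [sum_bilin_lie_sq b hb hQ ha] at h2
    refine h2.trans_eq ?_
    rw [Finset.sum_comm, hM]
    congr 1
    refine Finset.sum_congr rfl fun i _ => ?_
    rw [Finset.sum_comm]
    simp only [sum_bilin_lie_sq b hb hQ ha]
  have hK0 : 0 ≤ -ricciForm Q hQ H H := by
    rw [hK]
    exact mul_nonneg (by norm_num)
      (Finset.sum_nonneg fun i _ => Finset.sum_nonneg fun j _ => sq_nonneg _)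
  have hM0 : 0 ≤ M := by
    refine Finset.sum_nonneg fun i _ => Finset.sum_nonneg fun j _ => ?_
    rw [← sum_bilin_lie_sq b hb hQ ha]
    exact Finset.sum_nonneg fun _ _ => sq_nonneg _
  rw [sum_inr_symAd_sq b hb hQ ha hvm, hN] at hcs
  have hfin := hcs.trans (mul_le_mul_of_nonneg_left hanti (by positivity))
  have hc0 : 0 ≤ ∑ j, c j ^ 2 := Finset.sum_nonneg fun _ _ => sq_nonneg _
  change ∑ j, c j ^ 2 ≤ _
  rcases hc0.eq_or_lt with h0 | hpos
  · rw [← h0]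
    positivity
  · refine le_of_mul_le_mul_left ?_ hpos
    linarith

end MetricLie
end

/-! ### The main theorem -/

theorem theorem2 {s : Type*} [LieRing s] [LieAlgebra ℝ s] [FiniteDimensional ℝ s]
    (hsolv : LieAlgebra.IsSolvable s) (hs : ¬ MetricLie.IsUnimodular s)
    (Q : LinearMap.BilinForm ℝ s) (hQ : MetricLie.IsInnerProduct Q) :
    2 ≤ MetricLie.negEigenvalueCount (MetricLie.ricciOperator Q hQ) := by
  open MetricLie in
  obtain ⟨hpos, hskew⟩ := not_isSkewAd_meanCurvature hQ hs
  have hHmem := meanCurvature_mem hQ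
  have hH := ricciForm_neg_of_not_isSkewAd hQ hHmem hskew
  set H := meanCurvature Q hQ
  by_cases h : ∀ X ∈ bracketOrthogonal Q, ∃ t : ℝ, IsSkewAd Q (X - t • H)
  · have haa : ∀ X ∈ bracketOrthogonal Q, ∀ Y ∈ bracketOrthogonal Q, ⁅X, Y⁆ = 0 :=
      fun X hX Y hY => lie_eq_zero_of_forall_exists_isSkewAd hQ hHmem h hX hY
    obtain ⟨p, q, b, hb, ha, hm⟩ := exists_bracket_adapted_basis hQ
    have h1 := sum_inr_ricciForm b hb hQ ha hm haa
    have h2 := sum_ricciForm_meanCurvature_sq_le b hb hQ ha hm haa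
    obtain ⟨j, -, hj⟩ : ∃ j ∈ Finset.univ, -ricciForm Q hQ H H *
        ricciForm Q hQ (b (.inr j)) (b (.inr j)) + ricciForm Q hQ H (b (.inr j)) ^ 2 < 0 := by
      refine Finset.exists_lt_of_sum_lt (g := fun _ => (0 : ℝ)) ?_
      rw [Finset.sum_add_distrib, ← Finset.mul_sum, h1, Finset.sum_const_zero]
      have := mul_pos (neg_pos.mpr hH) hpos
      linarith
    exact two_le_negEigenvalueCount_of_det hQ H _ hH hj
  · push Not at h
    obtain ⟨X, hX, hXt⟩ := h
    refine two_le_negEigenvalueCount hQ H X fun x y hxy =>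
      ricciForm_neg_of_not_isSkewAd hQ
        (Submodule.add_mem _ (Submodule.smul_mem _ x hHmem) (Submodule.smul_mem _ y hX)) ?_
    intro hW
    by_cases hy : y = 0
    · have hx : x ≠ 0 := by simpa [hy] using hxy
      refine hskew ?_
      simpa [hy, hx, smul_smul] using hW.smul x⁻¹
    -- Dividing a skew xH + yX by y would exhibit a skew translate of X by a multiple of H.
    · refine hXt (-(y⁻¹ * x)) ?_
      convert hW.smul y⁻¹ using 1
      rw [smul_add, smul_smul, smul_smul, inv_mul_cancel₀ hy, one_smul, neg_smul, sub_neg_eq_add,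
        add_comm]
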